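/- Let $d$ be a non-negative integer (the dimension) and let $\alpha\in(0,1)$. Points of $\mathbb R\times\mathbb R^d$ are written $z=(t,x)$. Let $$d(z,\bar z)=\max\{|x-\bar x|,\sqrt{|t-\bar t|}\}$$ be the parabolic metric, and let $B(0,1)=\{(t,x): d((t,x),0)<1,\ t<0\}$ be the parabolic unit ball looking into the past. For $u:\mathbb R\times\mathbb R^d\to\mathbb R$ put $$[u]_\alpha=\sup_{z\ne\bar z}\frac{|u(z)-u(\bar z)|}{d(z,\bar z)^\alpha}\in[0,\infty],$$ and let $\|\cdot\|$ denote the supremum norm over $\mathbb R\times\mathbb R^d$, with values in $[0,\infty]$. A mollifying kernel is a non-negative smooth function $\Psi$ on $\mathbb R\times\mathbb R^d$ with compact support contained in $-B(0,1)$ and with integral $1$. For $T\in(0,1]$ set $\Psi_T(t,x)=T^{-(d+2)}\Psi(t/T^2,x/T)$, and for a distribution $f$ on $\mathbb R\times\mathbb R^d$ set $f_T=f*\Psi_T$, that is, $f_T(z)=\langle f,\Psi_T(z-\cdot)\rangle$. Lemma 5.1. There is a constant $C=C(\alpha,d)<\infty$ such that, for every mollifying kernel $\Psi$ and every continuous function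 $u:\mathbb R\times\mathbb R^d\to\mathbb R$ that is compactly supported in $B(0,1)$, the distribution $f:=(\partial_t-\Delta)u$ satisfies $$[u]_\alpha\le C\sup_{0<T\le 1}T^{2-\alpha}\|f_T\|.$$ Here $\Delta$ is the Laplacian in $x$, the derivatives are taken in the sense of distributions, and both sides may be $+\infty$. -/

import Mathlib

open MeasureTheory TopologicalSpace
open scoped ENNReal NNReal ContDiff Distributions

namespace ParabolicSchauder

noncomputable section

/-- Space-time `ℝ × ℝᵈ`; a point is `z = (t, x)`, with `z.1 = t` the time and `z.2 = x` the space
variable. -/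
abbrev SpaceTime (d : ℕ) : Type := ℝ × EuclideanSpace ℝ (Fin d)

/-- The parabolic metric `max {|x - x̄|, √|t - t̄|}`. -/
def parDist {d : ℕ} (z w : SpaceTime d) : ℝ :=
  max ‖z.2 - w.2‖ (√|z.1 - w.1|)

/-- The parabolic ball `B(z, R)`, looking only into the past. -/
def parBall {d : ℕ} (z : SpaceTime d) (R : ℝ) : Set (SpaceTime d) :=
  {w | parDist z w < R ∧ w.1 < z.1}

/-- The parabolic `α`-Hölder seminorm on the whole space, with values in `[0, ∞]`. -/
def holderSeminorm {d : ℕ} (α : ℝ) (u : SpaceTime d → ℝ) : ℝ≥0∞ :=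
  ⨆ (z : SpaceTime d) (w : SpaceTime d) (_ : z ≠ w),
    ENNReal.ofReal (|u z - u w| / parDist z w ^ α)

/-- The supremum norm on the whole space, with values in `[0, ∞]`. -/
def supNorm {d : ℕ} (g : SpaceTime d → ℝ) : ℝ≥0∞ :=
  ⨆ z : SpaceTime d, ENNReal.ofReal |g z|

/-- The distribution `η ↦ ∫ η u` on space-time given by a locally integrable function `u`. -/
def toDistribution {d : ℕ} (u : SpaceTime d → ℝ) : 𝓓'((⊤ : Opens (SpaceTime d)), ℝ) :=
  TestFunction.integralAgainstBilinCLM (ContinuousLinearMap.mul ℝ ℝ) volume u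

/-- The heat operator `∂ₜ - Δ` on distributions, `Δ = ∑ᵢ ∂ᵢ∂ᵢ` being the Laplacian in the space
variables. The derivatives are distributional: `(∂_{v} g) η = - g (∂_{v} η)`. -/
def heatOp {d : ℕ} (g : 𝓓'((⊤ : Opens (SpaceTime d)), ℝ)) :
    𝓓'((⊤ : Opens (SpaceTime d)), ℝ) :=
  let e : Fin d → SpaceTime d := fun i => (0, EuclideanSpace.single i 1)
  LineDeriv.lineDerivOp ((1, 0) : SpaceTime d) g -
    ∑ i : Fin d, LineDeriv.lineDerivOp (e i) (LineDeriv.lineDerivOp (e i) g)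

/-- A mollifying kernel: a non-negative smooth function `Ψ` on space-time with (compact) support in
`-B(0, 1)` and with integral `1`. -/
structure MollifierKernel (d : ℕ) where
  /-- the kernel, a smooth compactly supported function -/
  toTest : 𝓓((⊤ : Opens (SpaceTime d)), ℝ)
  nonneg : ∀ z, 0 ≤ toTest z
  tsupport_subset : tsupport toTest ⊆ {z | -z ∈ parBall 0 1}
  integral_eq_one : ∫ z, toTest z = 1

/-- The parabolically rescaled kernel `Ψ_T(t, x) = T^{-(d+2)} Ψ(t / T², x / T)`. -/
def MollifierKernel.scaled {d : ℕ} (Ψ : MollifierKernel d) (T : ℝ) (z : SpaceTime d) : ℝ :=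
  (T ^ (d + 2))⁻¹ * Ψ.toTest ((T ^ 2)⁻¹ * z.1, T⁻¹ • z.2)

lemma MollifierKernel.contDiff_scaled {d : ℕ} (Ψ : MollifierKernel d) (T : ℝ)
    (z : SpaceTime d) : ContDiff ℝ ∞ (fun w => Ψ.scaled T (z - w)) := by
  have h : ContDiff ℝ ∞ Ψ.toTest := Ψ.toTest.contDiff
  unfold MollifierKernel.scaled
  refine contDiff_const.mul (h.comp ?_)
  fun_prop

lemma MollifierKernel.hasCompactSupport_scaled {d : ℕ} (Ψ : MollifierKernel d) {T : ℝ}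
    (hT : 0 < T) (z : SpaceTime d) : HasCompactSupport (fun w => Ψ.scaled T (z - w)) := by
  have h : HasCompactSupport Ψ.toTest := Ψ.toTest.hasCompactSupport
  refine HasCompactSupport.intro
    (K := (fun y : SpaceTime d => (z.1 - T ^ 2 * y.1, z.2 - T • y.2)) '' tsupport Ψ.toTest)
    (h.isCompact.image (by fun_prop)) ?_
  intro w hw
  unfold MollifierKernel.scaled
  rw [image_eq_zero_of_notMem_tsupport (f := Ψ.toTest), mul_zero]
  intro hy
  refine hw ⟨_, hy, ?_⟩
  have hT' : T ≠ 0 := hT.ne'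
  ext1
  · simp [hT']
  · simp [smul_smul, hT']

/-- The test function `w ↦ Ψ_T(z - w)`. -/
def MollifierKernel.testAt {d : ℕ} (Ψ : MollifierKernel d) (T : Set.Ioc (0 : ℝ) 1)
    (z : SpaceTime d) : 𝓓((⊤ : Opens (SpaceTime d)), ℝ) where
  toFun := fun w => Ψ.scaled T (z - w)
  contDiff' := Ψ.contDiff_scaled T z
  hasCompactSupport' := Ψ.hasCompactSupport_scaled T.2.1 z
  tsupport_subset' := fun _ _ => trivial

/-- The regularisation `f_T = f * Ψ_T` of a distribution: `f_T(z) = ⟨f, Ψ_T(z - ·)⟩`. -/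
def mollify {d : ℕ} (Ψ : MollifierKernel d) (T : Set.Ioc (0 : ℝ) 1)
    (f : 𝓓'((⊤ : Opens (SpaceTime d)), ℝ)) (z : SpaceTime d) : ℝ :=
  f (Ψ.testAt T z)

/-- The global negative-order seminorm `[f]_{α-2} = sup_{0 < T ≤ 1} T^{2-α} ‖f_T‖`, with values in
`[0, ∞]`. -/
def negHolderSeminorm {d : ℕ} (Ψ : MollifierKernel d) (α : ℝ)
    (f : 𝓓'((⊤ : Opens (SpaceTime d)), ℝ)) : ℝ≥0∞ :=
  ⨆ T : Set.Ioc (0 : ℝ) 1, ENNReal.ofReal ((T : ℝ) ^ (2 - α)) * supNorm (mollify Ψ T f)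

end

end ParabolicSchauder

namespace ParabolicSchauder

noncomputable section

open scoped RealInnerProductSpace Convolution

variable {d : ℕ}

/-! ### The standard Gaussian weight -/

/-! The argument plays the scale `T` of the mollifier against the parabolic distance `r` of two
points and absorbs the Hölder constant of `u` into itself. Write `F` for a bound on `|(∂ₜ - Δ)h|`,
`γ` for the standard Gaussian measure and `κ = ∫ (1 + |y|²) dγ`.

No heat kernel or Duhamel formula is needed, only the averages `∫ h(t - σ²/2, x + σy) dγ(y)`.
Gaussian integration by parts shows that their `σ`-derivative is `-σ` times the same average of `(∂ₜ
- Δ)h`, so they differ from `h` by at most `σ²F` (`abs_sub_heatAverage_le`). If `h` is `α`-Hölder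
with constant `M`, its Gaussian average at scale `R` is Lipschitz in space with constant `κMR^(α-1)`
(`abs_gaussAverage_sub_le`). Together these bound the increments of `h` by terms in `F` and in
`MR^(α-1)r` (`abs_sub_le_of_heat_le`).

Apply this to `h = u_T`, where `F ≤ N T^(α-2)` with `N` the negative seminorm and `|u_T - u| ≤ M
T^α`. Taking `T = εr` with `ε` small and `R = Lr` with `L` large gives `|u(z) - u(w)| ≤ (M/2 + DN)
r^α`, hence `M ≤ 2DN` for the best `M` (`exists_isParHolder_of_approx`). Absorption needs a finite
`M` beforehand, so it is run on mollifications of `u`, and the mollification is removed at the end.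
Of the kernel only positivity, unit mass and support size enter, so the constant does not depend on
it. -/

lemma integrable_exp_neg_mul_sq_norm {b : ℝ} (hb : 0 < b) :
    Integrable (fun y : EuclideanSpace ℝ (Fin d) => Real.exp (-b * ‖y‖ ^ 2)) := by
  have h := (GaussianFourier.integrable_cexp_neg_mul_sq_norm_add (V := EuclideanSpace ℝ (Fin d))
    (b := (b : ℂ)) (by simpa using hb) 0 0).re
  refine h.congr (Filter.Eventually.of_forall fun y => ?_)
  have : (-(b : ℂ) * ‖y‖ ^ 2 + 0 * ((⟪(0 : EuclideanSpace ℝ (Fin d)), y⟫ : ℝ) : ℂ))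
      = ((-b * ‖y‖ ^ 2 : ℝ) : ℂ) := by push_cast; simp
  simp only [this]
  exact Complex.exp_ofReal_re _

/-- The density of the standard Gaussian on `ℝᵈ`. -/
def gaussWeight (y : EuclideanSpace ℝ (Fin d)) : ℝ :=
  (∫ x : EuclideanSpace ℝ (Fin d), Real.exp (-(1 / 2) * ‖x‖ ^ 2))⁻¹ * Real.exp (-(1 / 2) * ‖y‖ ^ 2)

lemma integral_exp_neg_half_mul_sq_norm_pos :
    0 < ∫ x : EuclideanSpace ℝ (Fin d), Real.exp (-(1 / 2) * ‖x‖ ^ 2) :=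
  integral_exp_pos (integrable_exp_neg_mul_sq_norm (by norm_num))

lemma gaussWeight_nonneg (y : EuclideanSpace ℝ (Fin d)) : 0 ≤ gaussWeight y := by
  have := integral_exp_neg_half_mul_sq_norm_pos (d := d)
  unfold gaussWeight
  positivity

lemma integral_gaussWeight : ∫ y : EuclideanSpace ℝ (Fin d), gaussWeight y = 1 := by
  unfold gaussWeight
  rw [integral_const_mul]
  exact inv_mul_cancel₀ integral_exp_neg_half_mul_sq_norm_pos.ne'

lemma contDiff_gaussWeight : ContDiff ℝ ∞ (gaussWeight (d := d)) := by
  unfold gaussWeight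
  have : ContDiff ℝ ∞ (fun y : EuclideanSpace ℝ (Fin d) => ‖y‖ ^ 2) := contDiff_norm_sq ℝ
  fun_prop

lemma continuous_gaussWeight : Continuous (gaussWeight (d := d)) :=
  contDiff_gaussWeight.continuous

lemma fderiv_gaussWeight (y v : EuclideanSpace ℝ (Fin d)) :
    fderiv ℝ gaussWeight y v = -(⟪y, v⟫ * gaussWeight y) := by
  have h : HasFDerivAt (fun y : EuclideanSpace ℝ (Fin d) => ‖y‖ ^ 2) (2 • innerSL ℝ y) y :=
    (hasStrictFDerivAt_norm_sq y).hasFDerivAt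
  have h2 := ((h.const_mul (-(1 / 2))).exp).const_mul
    (∫ x : EuclideanSpace ℝ (Fin d), Real.exp (-(1 / 2) * ‖x‖ ^ 2))⁻¹
  have h3 : HasFDerivAt gaussWeight _ y := h2
  rw [h3.fderiv]
  simp [gaussWeight]
  ring

/-- Half of the Gaussian exponent absorbs the polynomial, since `1 + |y|² ≤ 4 exp(|y|²/4)`. The
weight `1 + |y|²` is the common majorant for the factors `|y|` and `|y|^(1+α)` met later. -/
lemma integrable_one_add_sq_mul_gaussWeight :
    Integrable (fun y : EuclideanSpace ℝ (Fin d) => (1 + ‖y‖ ^ 2) * gaussWeight y) := by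
  have h1 := (integrable_exp_neg_mul_sq_norm (d := d) (b := 1 / 4) (by norm_num)).const_mul
    (4 * (∫ x : EuclideanSpace ℝ (Fin d), Real.exp (-(1 / 2) * ‖x‖ ^ 2))⁻¹)
  refine h1.mono' ?_ (Filter.Eventually.of_forall fun y => ?_)
  · exact ((continuous_const.add (continuous_norm.pow 2)).mul
      continuous_gaussWeight).aestronglyMeasurable
  · have hg := gaussWeight_nonneg y
    rw [Real.norm_of_nonneg (by positivity)]
    unfold gaussWeight
    have hI := inv_pos.2 (integral_exp_neg_half_mul_sq_norm_pos (d := d))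
    set I := (∫ x : EuclideanSpace ℝ (Fin d), Real.exp (-(1 / 2) * ‖x‖ ^ 2))⁻¹
    have e1 : Real.exp (-(1 / 2) * ‖y‖ ^ 2)
        = Real.exp (-(1 / 4) * ‖y‖ ^ 2) * Real.exp (-(1 / 4) * ‖y‖ ^ 2) := by
      rw [← Real.exp_add]; ring_nf
    have e2 : (1 + ‖y‖ ^ 2) * Real.exp (-(1 / 4) * ‖y‖ ^ 2) ≤ 4 := by
      have := Real.add_one_le_exp ((1 / 4) * ‖y‖ ^ 2)
      have e3 : Real.exp (-(1 / 4) * ‖y‖ ^ 2) = (Real.exp ((1 / 4) * ‖y‖ ^ 2))⁻¹ := by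
        rw [← Real.exp_neg]; ring_nf
      rw [e3, ← div_eq_mul_inv, div_le_iff₀ (Real.exp_pos _)]
      linarith
    rw [e1]
    calc _ = ((1 + ‖y‖ ^ 2) * Real.exp (-(1 / 4) * ‖y‖ ^ 2)) *
          (I * Real.exp (-(1 / 4) * ‖y‖ ^ 2)) := by ring
      _ ≤ 4 * (I * Real.exp (-(1 / 4) * ‖y‖ ^ 2)) := by gcongr
      _ = _ := by ring

lemma integrable_mul_gaussWeight {φ : EuclideanSpace ℝ (Fin d) → ℝ} (hφ : Continuous φ) {C : ℝ}
    (hC : ∀ y, |φ y| ≤ C * (1 + ‖y‖ ^ 2)) : Integrable (fun y => φ y * gaussWeight y) := by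
  refine (integrable_one_add_sq_mul_gaussWeight.const_mul C).mono'
    (hφ.mul continuous_gaussWeight).aestronglyMeasurable (Filter.Eventually.of_forall fun y => ?_)
  rw [norm_mul, Real.norm_of_nonneg (gaussWeight_nonneg y), ← mul_assoc]
  exact mul_le_mul_of_nonneg_right (hC y) (gaussWeight_nonneg y)

lemma integrable_gaussWeight : Integrable (gaussWeight (d := d)) := by
  simpa using integrable_mul_gaussWeight (d := d) (φ := fun _ => 1) (C := 1) continuous_const
    (fun y => by simp)

/-- The bound `∫ (1 + |y|²) dγ(y)` for moments of order at most two. -/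
def gaussMoment (d : ℕ) : ℝ := ∫ y : EuclideanSpace ℝ (Fin d), (1 + ‖y‖ ^ 2) * gaussWeight y

lemma one_le_gaussMoment : 1 ≤ gaussMoment d := by
  rw [← integral_gaussWeight (d := d)]
  refine integral_mono integrable_gaussWeight integrable_one_add_sq_mul_gaussWeight fun y => ?_
  have := gaussWeight_nonneg y
  nlinarith [mul_nonneg (sq_nonneg ‖y‖) this]

lemma abs_integral_mul_gaussWeight_le {φ : EuclideanSpace ℝ (Fin d) → ℝ} {C : ℝ}
    (hC : ∀ y, |φ y| ≤ C * (1 + ‖y‖ ^ 2)) :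
    |∫ y, φ y * gaussWeight y| ≤ C * gaussMoment d := by
  rw [gaussMoment, ← integral_const_mul]
  rw [← Real.norm_eq_abs]
  refine norm_integral_le_of_norm_le (integrable_one_add_sq_mul_gaussWeight.const_mul C)
    (Filter.Eventually.of_forall fun y => ?_)
  rw [norm_mul, Real.norm_of_nonneg (gaussWeight_nonneg y), ← mul_assoc]
  exact mul_le_mul_of_nonneg_right (hC y) (gaussWeight_nonneg y)

lemma abs_integral_mul_gaussWeight_le_of_bounded {φ : EuclideanSpace ℝ (Fin d) → ℝ} {C : ℝ}
    (hC : ∀ y, |φ y| ≤ C) : |∫ y, φ y * gaussWeight y| ≤ C := by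
  have : ∫ y : EuclideanSpace ℝ (Fin d), C * gaussWeight y = C := by
    rw [integral_const_mul, integral_gaussWeight, mul_one]
  rw [← this]
  rw [← Real.norm_eq_abs]
  refine norm_integral_le_of_norm_le (integrable_gaussWeight.const_mul C)
    (Filter.Eventually.of_forall fun y => ?_)
  rw [norm_mul, Real.norm_of_nonneg (gaussWeight_nonneg y)]
  exact mul_le_mul_of_nonneg_right (hC y) (gaussWeight_nonneg y)

lemma abs_inner_le_mul_one_add_sq (y v : EuclideanSpace ℝ (Fin d)) :
    |⟪y, v⟫| ≤ ‖v‖ * (1 + ‖y‖ ^ 2) := by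
  have := abs_real_inner_le_norm y v
  nlinarith [norm_nonneg y, norm_nonneg v, mul_nonneg (norm_nonneg v) (sq_nonneg (‖y‖ - 1 / 2))]

/-- Gaussian integration by parts. -/
lemma integral_inner_mul_gaussWeight {k : EuclideanSpace ℝ (Fin d) → ℝ} (hk : ContDiff ℝ 1 k)
    (v : EuclideanSpace ℝ (Fin d)) {C : ℝ} (hC : ∀ y, |k y| ≤ C)
    (hC' : ∀ y, |fderiv ℝ k y v| ≤ C) (x : EuclideanSpace ℝ (Fin d)) (σ : ℝ) :
    ∫ y, (⟪y, v⟫ * k (x + σ • y)) * gaussWeight y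
      = σ * ∫ y, fderiv ℝ k (x + σ • y) v * gaussWeight y := by
  have hC0 : 0 ≤ C := (abs_nonneg _).trans (hC 0)
  set g : EuclideanSpace ℝ (Fin d) → ℝ := fun y => k (x + σ • y) with hg
  have hkd : Differentiable ℝ k := hk.differentiable one_ne_zero
  have hkc : Continuous fun y => fderiv ℝ k y v :=
    (hk.continuous_fderiv one_ne_zero).clm_apply continuous_const
  have haff : Continuous fun y : EuclideanSpace ℝ (Fin d) => x + σ • y := by fun_prop
  have hgd : ∀ y, fderiv ℝ g y v = σ * fderiv ℝ k (x + σ • y) v := by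
    intro y
    have h1 : HasFDerivAt (fun y : EuclideanSpace ℝ (Fin d) => x + σ • y)
        (σ • ContinuousLinearMap.id ℝ _) y :=
      ((hasFDerivAt_id y).const_smul σ).const_add x
    have h2 := (hkd (x + σ • y)).hasFDerivAt.comp y h1
    have h3 : HasFDerivAt g _ y := h2
    rw [h3.fderiv]
    simp
  have hi1 : Integrable fun y => (⟪y, v⟫ * g y) * gaussWeight y := by
    refine integrable_mul_gaussWeight (C := ‖v‖ * C) ?_ fun y => ?_
    · have := hk.continuous.comp haff
      exact (continuous_id.inner continuous_const).mul this
    · rw [abs_mul]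
      calc _ ≤ (‖v‖ * (1 + ‖y‖ ^ 2)) * C :=
            mul_le_mul (abs_inner_le_mul_one_add_sq y v) (hC _) (abs_nonneg _) (by positivity)
        _ = _ := by ring
  have hone : ∀ y : EuclideanSpace ℝ (Fin d), C ≤ C * (1 + ‖y‖ ^ 2) := fun y => by
    nlinarith [mul_nonneg hC0 (sq_nonneg ‖y‖)]
  have hi2 : Integrable fun y => fderiv ℝ k (x + σ • y) v * gaussWeight y :=
    integrable_mul_gaussWeight (hkc.comp haff) fun y => (hC' _).trans (hone y)
  have hi3 : Integrable fun y => g y * gaussWeight y :=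
    integrable_mul_gaussWeight (hk.continuous.comp haff) fun y => (hC _).trans (hone y)
  -- The derivative of the Gaussian density in direction `v` is `-⟪y, v⟫` times the density, which
  -- produces the inner product; the factor `σ` is the chain rule.
  have key := integral_mul_fderiv_eq_neg_fderiv_mul_of_integrable (μ := volume)
    (f := gaussWeight (d := d)) (g := g) (v := v) ?_ ?_ ?_ ?_ ?_
  · have e1 : ∫ y, gaussWeight y * fderiv ℝ g y v
        = σ * ∫ y, fderiv ℝ k (x + σ • y) v * gaussWeight y := by
      rw [← integral_const_mul]
      exact integral_congr_ae (Filter.Eventually.of_forall fun y => by simp only [hgd]; ring)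
    have e2 : ∫ y, fderiv ℝ gaussWeight y v * g y
        = - ∫ y, (⟪y, v⟫ * g y) * gaussWeight y := by
      rw [← integral_neg]
      exact integral_congr_ae
        (Filter.Eventually.of_forall fun y => by simp only [fderiv_gaussWeight]; ring)
    rw [e1, e2, neg_neg] at key
    exact key.symm
  · refine hi1.neg.congr (Filter.Eventually.of_forall fun y => ?_)
    simp only [fderiv_gaussWeight, Pi.neg_apply]; ring
  · refine (hi2.const_mul σ).congr (Filter.Eventually.of_forall fun y => ?_)
    simp only [hgd]; ring
  · exact hi3.congr (Filter.Eventually.of_forall fun y => mul_comm _ _)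
  · exact fun y _ => (contDiff_gaussWeight.differentiable (by simp)).differentiableAt
  · exact fun y _ => (hkd _).comp y (by fun_prop)

/-- Differentiation under the Gaussian integral. -/
lemma hasDerivAt_integral_mul_gaussWeight {p p' : ℝ → EuclideanSpace ℝ (Fin d) → ℝ} {σ₀ C : ℝ}
    (hp : ∀ σ, Continuous (p σ)) (hp' : ∀ σ, Continuous (p' σ))
    (hderiv : ∀ σ y, HasDerivAt (fun s => p s y) (p' σ y) σ)
    (hb : ∀ y, |p σ₀ y| ≤ C) (hb' : ∀ σ ∈ Metric.ball σ₀ 1, ∀ y, |p' σ y| ≤ C * (1 + ‖y‖ ^ 2)) :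
    HasDerivAt (fun σ => ∫ y, p σ y * gaussWeight y) (∫ y, p' σ₀ y * gaussWeight y) σ₀ := by
  have hC0 : 0 ≤ C := (abs_nonneg _).trans (hb 0)
  refine (hasDerivAt_integral_of_dominated_loc_of_deriv_le (μ := volume)
    (F := fun σ y => p σ y * gaussWeight y) (F' := fun σ y => p' σ y * gaussWeight y)
    (bound := fun y => C * ((1 + ‖y‖ ^ 2) * gaussWeight y)) (Metric.ball_mem_nhds σ₀ one_pos)
    ?_ ?_ ?_ ?_ ?_ ?_).2
  · exact Filter.Eventually.of_forall fun σ =>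
      ((hp σ).mul continuous_gaussWeight).aestronglyMeasurable
  · refine integrable_mul_gaussWeight (C := C) (hp σ₀) fun y => (hb y).trans ?_
    nlinarith [mul_nonneg hC0 (sq_nonneg ‖y‖)]
  · exact ((hp' σ₀).mul continuous_gaussWeight).aestronglyMeasurable
  · refine Filter.Eventually.of_forall fun y σ hσ => ?_
    rw [norm_mul, Real.norm_of_nonneg (gaussWeight_nonneg y), ← mul_assoc]
    exact mul_le_mul_of_nonneg_right (hb' σ hσ y) (gaussWeight_nonneg y)
  · exact integrable_one_add_sq_mul_gaussWeight.const_mul C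
  · exact Filter.Eventually.of_forall fun y σ _ => (hderiv σ y).mul_const _

/-! ### The heat operator on smooth functions -/

/-- The derivative of `h` in direction `v`. -/
def dirDeriv (v : SpaceTime d) (h : SpaceTime d → ℝ) (z : SpaceTime d) : ℝ := fderiv ℝ h z v

/-- The unit vector in the `i`-th space direction. -/
def spaceDir (i : Fin d) : SpaceTime d := (0, EuclideanSpace.single i 1)

/-- The unit vector in time direction. -/
def timeDir : SpaceTime d := (1, 0)

/-- The classical heat operator `∂ₜ - Δ`. -/
def heat (h : SpaceTime d → ℝ) (z : SpaceTime d) : ℝ :=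
  dirDeriv timeDir h z - ∑ i, dirDeriv (spaceDir i) (dirDeriv (spaceDir i) h) z

lemma _root_.ContDiff.dirDeriv {h : SpaceTime d → ℝ} (hh : ContDiff ℝ ∞ h) (v : SpaceTime d) :
    ContDiff ℝ ∞ (dirDeriv v h) :=
  (hh.fderiv_right (m := ∞) (by simp)).clm_apply contDiff_const

lemma _root_.HasCompactSupport.dirDeriv {h : SpaceTime d → ℝ} (hh : HasCompactSupport h)
    (v : SpaceTime d) : HasCompactSupport (dirDeriv v h) :=
  hh.fderiv_apply ℝ v

lemma exists_abs_le {h : SpaceTime d → ℝ} (hh : Continuous h) (hs : HasCompactSupport h) :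
    ∃ C, ∀ z, |h z| ≤ C := hs.exists_bound_of_continuous hh

lemma _root_.ContDiff.heat {h : SpaceTime d → ℝ} (hh : ContDiff ℝ ∞ h) : ContDiff ℝ ∞ (heat h) :=
  (hh.dirDeriv _).sub (ContDiff.sum fun _ _ => (hh.dirDeriv _).dirDeriv _)

lemma euclideanSpace_eq_sum_smul_single (y : EuclideanSpace ℝ (Fin d)) :
    y = ∑ i, y i • EuclideanSpace.single i (1 : ℝ) := by
  ext j
  simp [Finset.sum_apply, Pi.single_apply]

lemma spaceTime_eq_sum (s : ℝ) (y : EuclideanSpace ℝ (Fin d)) :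
    ((s, y) : SpaceTime d) = s • timeDir + ∑ i, y i • spaceDir i := by
  have h : ∑ i, y i • spaceDir i = ((0, y) : SpaceTime d) := by
    have e : ∀ i, y i • spaceDir i = ((0, y i • EuclideanSpace.single i (1 : ℝ)) : SpaceTime d) :=
      fun i => by simp [spaceDir]
    simp only [e]
    ext1
    · simp [Prod.fst_sum]
    · simp only [Prod.snd_sum]
      exact (euclideanSpace_eq_sum_smul_single y).symm
  rw [h, timeDir]
  simp

/-! ### Averages along the backward heat flow -/

lemma hasFDerivAt_space_slice {h : SpaceTime d → ℝ} (hh : ContDiff ℝ ∞ h) (t : ℝ)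
    (x : EuclideanSpace ℝ (Fin d)) :
    HasFDerivAt (fun x => h (t, x)) ((fderiv ℝ h (t, x)).comp (.inr ℝ ℝ _)) x :=
  ((hh.differentiable (by simp)) (t, x)).hasFDerivAt.comp x (hasFDerivAt_prodMk_right t x)

lemma contDiff_space_slice {h : SpaceTime d → ℝ} (hh : ContDiff ℝ ∞ h) (t : ℝ) :
    ContDiff ℝ ∞ (fun x => h (t, x)) :=
  hh.comp (contDiff_const.prodMk contDiff_id)

/-- Averages of `h` along the backward heat flow. -/
def heatAverage (h : SpaceTime d → ℝ) (z : SpaceTime d) (σ : ℝ) : ℝ :=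
  ∫ y, h (z.1 - σ ^ 2 / 2, z.2 + σ • y) * gaussWeight y

/-- The chain rule gives the average of `-σ ∂ₜh + y·∇h`, and Gaussian integration by parts turns
each `yᵢ ∂ᵢh` into `σ ∂ᵢ∂ᵢh`. The time shift `σ²/2` is the one for which both terms carry the same
factor `σ`. -/
lemma hasDerivAt_heatAverage {h : SpaceTime d → ℝ} (hh : ContDiff ℝ ∞ h)
    (hs : HasCompactSupport h) (z : SpaceTime d) (σ : ℝ) :
    HasDerivAt (heatAverage h z)
      (-(σ * ∫ y, heat h (z.1 - σ ^ 2 / 2, z.2 + σ • y) * gaussWeight y)) σ := by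
  set q : ℝ → EuclideanSpace ℝ (Fin d) → SpaceTime d :=
    fun σ y => (z.1 - σ ^ 2 / 2, z.2 + σ • y) with hq
  have hqc : ∀ σ, Continuous (q σ) := fun σ => by simp only [hq]; fun_prop
  obtain ⟨C₀, hC₀⟩ := exists_abs_le hh.continuous hs
  obtain ⟨C₁, hC₁⟩ := (hs.fderiv ℝ).exists_bound_of_continuous
    (hh.continuous_fderiv (by simp))
  have hC₁0 : 0 ≤ C₁ := (norm_nonneg _).trans (hC₁ 0)
  have hC₀0 : 0 ≤ C₀ := (abs_nonneg _).trans (hC₀ 0)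
  have hb : ∀ v, ∃ C, ∀ z, |dirDeriv v h z| ≤ C := fun v =>
    exists_abs_le (hh.dirDeriv v).continuous (hs.dirDeriv v)
  have hb2 : ∀ v, ∃ C, ∀ z, |dirDeriv v (dirDeriv v h) z| ≤ C := fun v =>
    exists_abs_le ((hh.dirDeriv v).dirDeriv v).continuous ((hs.dirDeriv v).dirDeriv v)
  have main : HasDerivAt (heatAverage h z)
      (∫ y, fderiv ℝ h (q σ y) (-σ, y) * gaussWeight y) σ := by
    refine hasDerivAt_integral_mul_gaussWeight (p := fun σ y => h (q σ y))
      (p' := fun σ y => fderiv ℝ h (q σ y) (-σ, y)) (C := C₀ + C₁ * (|σ| + 2))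
      (fun s => hh.continuous.comp (hqc s)) (fun s => ?_) (fun s y => ?_) (fun y => ?_)
      (fun s hs y => ?_)
    · exact ((hh.continuous_fderiv (by simp)).comp (hqc s)).clm_apply (by fun_prop)
    · have h1 : HasDerivAt (fun s => q s y) (-s, y) s := by
        have a : HasDerivAt (fun s : ℝ => z.1 - s ^ 2 / 2) (-s) s := by
          exact (((hasDerivAt_pow 2 s).div_const 2).const_sub z.1).congr_deriv (by simp)
        have b : HasDerivAt (fun s : ℝ => z.2 + s • y) y s := by
          simpa using ((hasDerivAt_id s).smul_const y).const_add z.2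
        exact a.prodMk b
      exact ((hh.differentiable (by simp)) (q s y)).hasFDerivAt.comp_hasDerivAt s h1
    · refine (hC₀ _).trans ?_
      have : 0 ≤ C₁ * (|σ| + 2) := by positivity
      linarith
    · have hs' : |s| ≤ |σ| + 1 := by
        rw [Metric.mem_ball, Real.dist_eq] at hs
        have := abs_sub_abs_le_abs_sub s σ
        linarith
      have e1 : ‖((-s, y) : SpaceTime d)‖ ≤ (|σ| + 2) * (1 + ‖y‖ ^ 2) := by
        rw [Prod.norm_mk, norm_neg, Real.norm_eq_abs]
        have := abs_nonneg σ
        refine max_le ?_ ?_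
        · nlinarith [mul_nonneg this (sq_nonneg ‖y‖), sq_nonneg ‖y‖]
        · nlinarith [mul_nonneg this (sq_nonneg ‖y‖), sq_nonneg (‖y‖ - 1)]
      calc _ ≤ ‖fderiv ℝ h (q s y)‖ * ‖((-s, y) : SpaceTime d)‖ :=
            ContinuousLinearMap.le_opNorm _ _
        _ ≤ C₁ * ((|σ| + 2) * (1 + ‖y‖ ^ 2)) := by gcongr; exact hC₁ _
        _ ≤ _ := by nlinarith [mul_nonneg hC₀0 (sq_nonneg ‖y‖)]
  have hint : ∀ {φ : SpaceTime d → ℝ}, Continuous φ → (∃ C, ∀ z, |φ z| ≤ C) →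
      Integrable fun y => φ (q σ y) * gaussWeight y := by
    rintro φ hφ ⟨C, hC⟩
    refine integrable_mul_gaussWeight (C := C) (hφ.comp (hqc σ)) fun y => (hC _).trans ?_
    nlinarith [mul_nonneg ((abs_nonneg _).trans (hC 0)) (sq_nonneg ‖y‖)]
  have hibp : ∀ i, Integrable (fun y => (y i * dirDeriv (spaceDir i) h (q σ y)) * gaussWeight y) ∧
      ∫ y, (y i * dirDeriv (spaceDir i) h (q σ y)) * gaussWeight y
      = σ * ∫ y, dirDeriv (spaceDir i) (dirDeriv (spaceDir i) h) (q σ y) * gaussWeight y := by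
    intro i
    have hk := contDiff_space_slice (hh.dirDeriv (spaceDir i)) (z.1 - σ ^ 2 / 2)
    obtain ⟨A, hA⟩ := hb (spaceDir i)
    obtain ⟨A', hA'⟩ := hb2 (spaceDir i)
    have hder : ∀ x, fderiv ℝ (fun x => dirDeriv (spaceDir i) h (z.1 - σ ^ 2 / 2, x)) x
        (EuclideanSpace.single i 1)
        = dirDeriv (spaceDir i) (dirDeriv (spaceDir i) h) (z.1 - σ ^ 2 / 2, x) := by
      intro x
      rw [(hasFDerivAt_space_slice (hh.dirDeriv _) _ x).fderiv]
      rfl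
    have hin : ∀ y : EuclideanSpace ℝ (Fin d), ⟪y, EuclideanSpace.single i (1 : ℝ)⟫ = y i :=
      fun y => by simp [EuclideanSpace.inner_single_right]
    constructor
    · refine integrable_mul_gaussWeight (C := A) ?_ fun y => ?_
      · exact (by fun_prop : Continuous fun y : EuclideanSpace ℝ (Fin d) => y i).mul
          ((hh.dirDeriv _).continuous.comp (hqc σ))
      · have h1 := abs_inner_le_mul_one_add_sq y (EuclideanSpace.single i (1 : ℝ))
        rw [hin] at h1
        simp only [PiLp.norm_single, norm_one, one_mul] at h1
        rw [abs_mul, mul_comm]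
        exact mul_le_mul (hA _) h1 (abs_nonneg _) ((abs_nonneg _).trans (hA 0))
    · have := integral_inner_mul_gaussWeight (hk.of_le (by simp)) (EuclideanSpace.single i (1 : ℝ))
        (C := max A A') (fun y => (hA _).trans (le_max_left _ _))
        (fun y => by rw [hder]; exact (hA' _).trans (le_max_right _ _)) z.2 σ
      simp only [hin, hder] at this
      exact this
  convert main using 1
  have hsplit : ∀ y, fderiv ℝ h (q σ y) (-σ, y) * gaussWeight y
      = -σ * (dirDeriv timeDir h (q σ y) * gaussWeight y) +
        ∑ i, (y i * dirDeriv (spaceDir i) h (q σ y)) * gaussWeight y := by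
    intro y
    rw [spaceTime_eq_sum, map_add, map_sum]
    simp only [map_smul, smul_eq_mul, dirDeriv]
    rw [add_mul, Finset.sum_mul]
    ring
  have hsplit2 : ∀ y, heat h (q σ y) * gaussWeight y
      = dirDeriv timeDir h (q σ y) * gaussWeight y -
        ∑ i, dirDeriv (spaceDir i) (dirDeriv (spaceDir i) h) (q σ y) * gaussWeight y := by
    intro y
    rw [heat, sub_mul, Finset.sum_mul]
  have hI1 := hint (hh.dirDeriv timeDir).continuous (hb timeDir)
  have hI2 := fun i => hint ((hh.dirDeriv (spaceDir i)).dirDeriv (spaceDir i)).continuous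
    (hb2 (spaceDir i))
  change -(σ * ∫ y, heat h (q σ y) * gaussWeight y) = _
  simp only [hsplit, hsplit2]
  rw [integral_sub hI1 (integrable_finsetSum _ fun i _ => hI2 i),
    integral_add (hI1.const_mul _) (integrable_finsetSum _ fun i _ => (hibp i).1),
    integral_finsetSum _ (fun i _ => hI2 i), integral_finsetSum _ (fun i _ => (hibp i).1),
    integral_const_mul, Finset.sum_congr rfl fun i _ => (hibp i).2, ← Finset.mul_sum]
  ring

lemma abs_sub_heatAverage_le {h : SpaceTime d → ℝ} (hh : ContDiff ℝ ∞ h)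
    (hs : HasCompactSupport h) {F : ℝ} (hF : ∀ z, |heat h z| ≤ F) (z : SpaceTime d) {σ : ℝ}
    (hσ : 0 ≤ σ) : |heatAverage h z σ - h z| ≤ σ ^ 2 * F := by
  have h0 : heatAverage h z 0 = h z := by
    simp [heatAverage, integral_const_mul, integral_gaussWeight]
  have hmain := norm_image_sub_le_of_norm_deriv_le_segment' (f := heatAverage h z) (a := 0) (b := σ)
    (C := σ * F) (fun s _ => (hasDerivAt_heatAverage hh hs z s).hasDerivWithinAt)
    (fun s hs => by
      rw [norm_neg, norm_mul, Real.norm_of_nonneg hs.1]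
      exact mul_le_mul hs.2.le (abs_integral_mul_gaussWeight_le_of_bounded fun y => hF _)
        (norm_nonneg _) hσ) σ ⟨hσ, le_rfl⟩
  rw [h0, Real.norm_eq_abs] at hmain
  calc _ ≤ _ := hmain
    _ = _ := by ring

/-- Gaussian averages of an `α`-Hölder function are Lipschitz. -/
lemma abs_gaussAverage_sub_le {g : EuclideanSpace ℝ (Fin d) → ℝ} (hg : ContDiff ℝ 1 g)
    (hs : HasCompactSupport g) {α M : ℝ} (hα₀ : 0 < α) (hα₁ : α < 1) (hM : 0 ≤ M)
    (hH : ∀ x y, |g x - g y| ≤ M * ‖x - y‖ ^ α) {R : ℝ} (hR : 0 < R)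
    (x x' : EuclideanSpace ℝ (Fin d)) :
    |(∫ y, g (x' + R • y) * gaussWeight y) - ∫ y, g (x + R • y) * gaussWeight y|
      ≤ gaussMoment d * M * R ^ (α - 1) * ‖x' - x‖ := by
  set v := x' - x with hv
  obtain ⟨C₀, hC₀⟩ := hs.exists_bound_of_continuous hg.continuous
  obtain ⟨C₁, hC₁⟩ := (hs.fderiv ℝ).exists_bound_of_continuous
    (hg.continuous_fderiv one_ne_zero)
  have hC₁v : ∀ y, |fderiv ℝ g y v| ≤ C₁ * ‖v‖ := fun y =>
    (ContinuousLinearMap.le_opNorm _ _).trans (mul_le_mul_of_nonneg_right (hC₁ y) (norm_nonneg v))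
  have hC₀0 : 0 ≤ C₀ := (norm_nonneg _).trans (hC₀ 0)
  have hC₁0 : 0 ≤ C₁ := (norm_nonneg _).trans (hC₁ 0)
  have hder : ∀ s : ℝ, HasDerivAt (fun s : ℝ => ∫ y, g ((x + s • v) + R • y) * gaussWeight y)
      (∫ y, fderiv ℝ g ((x + s • v) + R • y) v * gaussWeight y) s := by
    intro s
    refine hasDerivAt_integral_mul_gaussWeight (p := fun s y => g ((x + s • v) + R • y))
      (p' := fun s y => fderiv ℝ g ((x + s • v) + R • y) v) (C := C₀ + C₁ * ‖v‖)
      (fun s => hg.continuous.comp (by fun_prop)) (fun s => ?_) (fun s y => ?_) (fun y => ?_)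
      (fun s hs y => ?_)
    · exact ((hg.continuous_fderiv one_ne_zero).comp (by fun_prop)).clm_apply continuous_const
    · have h1 : HasDerivAt (fun s : ℝ => (x + s • v) + R • y) v s := by
        simpa using (((hasDerivAt_id s).smul_const v).const_add x).add_const (R • y)
      exact ((hg.differentiable one_ne_zero) _).hasFDerivAt.comp_hasDerivAt s h1
    · have := mul_nonneg hC₁0 (norm_nonneg v)
      have h2 := hC₀ ((x + s • v) + R • y)
      rw [Real.norm_eq_abs] at h2
      linarith
    · have := mul_nonneg hC₁0 (norm_nonneg v)
      have := hC₁v ((x + s • v) + R • y)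
      nlinarith [mul_nonneg hC₀0 (sq_nonneg ‖y‖), mul_nonneg ‹0 ≤ C₁ * ‖v‖› (sq_nonneg ‖y‖)]
  have hbound : ∀ s : ℝ, |∫ y, fderiv ℝ g ((x + s • v) + R • y) v * gaussWeight y|
      ≤ gaussMoment d * M * R ^ (α - 1) * ‖v‖ := by
    intro s
    set w := x + s • v
    -- Subtracting the value at the centre `w` leaves the derivative unchanged. After the derivative
    -- is moved onto the Gaussian, the Hölder bound applies and contributes `M R^α |y|^α`; dividing
    -- by the factor `R` from the integration by parts leaves `R^(α-1)`.
    have hk : ContDiff ℝ 1 fun y => g y - g w := hg.sub contDiff_const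
    have hfd : ∀ y, fderiv ℝ (fun y => g y - g w) y = fderiv ℝ g y := fun y => fderiv_sub_const _
    have ibp := integral_inner_mul_gaussWeight hk v (C := 2 * C₀ + C₁ * ‖v‖)
      (fun y => by
        have h1 := hC₀ y
        have h2 := hC₀ w
        rw [Real.norm_eq_abs] at h1 h2
        have := mul_nonneg hC₁0 (norm_nonneg v)
        have := abs_sub (g y) (g w)
        linarith)
      (fun y => by rw [hfd]; linarith [hC₁v y]) w R
    simp only [hfd] at ibp
    have hb : |∫ y, (⟪y, v⟫ * (g (w + R • y) - g w)) * gaussWeight y|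
        ≤ (‖v‖ * M * R ^ α) * gaussMoment d := by
      refine abs_integral_mul_gaussWeight_le fun y => ?_
      rw [abs_mul]
      have h1 := abs_real_inner_le_norm y v
      have h2 := hH (w + R • y) w
      rw [add_sub_cancel_left, norm_smul, Real.norm_of_nonneg hR.le,
        Real.mul_rpow hR.le (norm_nonneg _)] at h2
      have h3 : ‖y‖ * ‖y‖ ^ α ≤ 1 + ‖y‖ ^ 2 := by
        rcases le_total ‖y‖ 1 with h | h
        · have := Real.rpow_le_one (norm_nonneg y) h hα₀.le
          nlinarith [norm_nonneg y, sq_nonneg ‖y‖, Real.rpow_nonneg (norm_nonneg y) α]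
        · have : ‖y‖ ^ α ≤ ‖y‖ := by
            simpa using Real.rpow_le_rpow_of_exponent_le h hα₁.le
          nlinarith [norm_nonneg y]
      calc _ ≤ (‖y‖ * ‖v‖) * (M * (R ^ α * ‖y‖ ^ α)) := by gcongr
        _ = (‖v‖ * M * R ^ α) * (‖y‖ * ‖y‖ ^ α) := by ring
        _ ≤ _ := by gcongr
    rw [ibp, abs_mul, abs_of_pos hR] at hb
    have hR1 : R ^ α = R ^ (α - 1) * R := by
      rw [Real.rpow_sub_one hR.ne']; field_simp
    rw [hR1] at hb
    refine le_of_mul_le_mul_left (hb.trans_eq ?_) hR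
    ring
  have := norm_image_sub_le_of_norm_deriv_le_segment_01'
    (f := fun s : ℝ => ∫ y, g ((x + s • v) + R • y) * gaussWeight y)
    (fun s _ => (hder s).hasDerivWithinAt) (fun s _ => hbound s)
  simpa [hv] using this

/-! ### The parabolic distance -/

lemma parDist_nonneg (z w : SpaceTime d) : 0 ≤ parDist z w :=
  (norm_nonneg _).trans (le_max_left _ _)

lemma parDist_comm (z w : SpaceTime d) : parDist z w = parDist w z := by
  rw [parDist, parDist, norm_sub_rev, abs_sub_comm]

lemma norm_snd_sub_le_parDist (z w : SpaceTime d) : ‖z.2 - w.2‖ ≤ parDist z w := le_max_left _ _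

lemma abs_fst_sub_le_parDist_sq (z w : SpaceTime d) : |z.1 - w.1| ≤ parDist z w ^ 2 := by
  rw [← Real.sq_sqrt (abs_nonneg (z.1 - w.1))]
  exact pow_le_pow_left₀ (Real.sqrt_nonneg _) (le_max_right _ _) 2

lemma parDist_triangle (z w y : SpaceTime d) : parDist z y ≤ parDist z w + parDist w y := by
  refine max_le ?_ ?_
  · calc ‖z.2 - y.2‖ ≤ ‖z.2 - w.2‖ + ‖w.2 - y.2‖ := norm_sub_le_norm_sub_add_norm_sub _ _ _
      _ ≤ _ := add_le_add (le_max_left _ _) (le_max_left _ _)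
  · rw [Real.sqrt_le_left (add_nonneg (parDist_nonneg _ _) (parDist_nonneg _ _))]
    have h1 := abs_fst_sub_le_parDist_sq z w
    have h2 := abs_fst_sub_le_parDist_sq w y
    have h3 := abs_sub_le z.1 w.1 y.1
    nlinarith [parDist_nonneg z w, parDist_nonneg w y,
      mul_nonneg (parDist_nonneg z w) (parDist_nonneg w y)]

lemma parDist_pos {z w : SpaceTime d} (h : z ≠ w) : 0 < parDist z w := by
  refine lt_of_le_of_ne (parDist_nonneg _ _) fun h0 => h ?_
  have h1 := norm_snd_sub_le_parDist z w
  have h2 := abs_fst_sub_le_parDist_sq z w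
  rw [← h0] at h1 h2
  ext1
  · exact sub_eq_zero.1 (abs_nonpos_iff.1 (by simpa using h2))
  · exact sub_eq_zero.1 (norm_le_zero_iff.1 h1)

lemma parDist_sub_right (z w y : SpaceTime d) : parDist (z - y) (w - y) = parDist z w := by
  simp [parDist]

/-- `h` is `α`-Hölder continuous with constant `M` in the parabolic metric. -/
def IsParHolder (α M : ℝ) (h : SpaceTime d → ℝ) : Prop :=
  ∀ z w, |h z - h w| ≤ M * parDist z w ^ α

/-! ### The heat equation and Hölder estimates -/

lemma hasCompactSupport_space_slice {h : SpaceTime d → ℝ} (hs : HasCompactSupport h) (t : ℝ) :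
    HasCompactSupport fun x => h (t, x) := by
  refine HasCompactSupport.intro (hs.isCompact.image continuous_snd) fun x hx => ?_
  exact image_eq_zero_of_notMem_tsupport fun hy => hx ⟨_, hy, rfl⟩

/-- Both values are replaced by their heat averages at scale `R`, each at cost `R²F`, and the two
averages are compared by the Lipschitz bound on the common time slice `t - R²/2`. -/
lemma abs_sub_le_of_heat_le_space {h : SpaceTime d → ℝ} (hh : ContDiff ℝ ∞ h)
    (hs : HasCompactSupport h) {α M F : ℝ} (hα₀ : 0 < α) (hα₁ : α < 1) (hM : 0 ≤ M)
    (hH : IsParHolder α M h) (hF : ∀ z, |heat h z| ≤ F) {R : ℝ} (hR : 0 < R) (t : ℝ)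
    (x x' : EuclideanSpace ℝ (Fin d)) :
    |h (t, x') - h (t, x)|
      ≤ 2 * R ^ 2 * F + gaussMoment d * M * R ^ (α - 1) * ‖x' - x‖ := by
  have h1 := abs_sub_heatAverage_le hh hs hF (t, x) hR.le
  have h2 := abs_sub_heatAverage_le hh hs hF (t, x') hR.le
  have h3 := abs_gaussAverage_sub_le
    ((contDiff_space_slice hh (t - R ^ 2 / 2)).of_le (by simp))
    (hasCompactSupport_space_slice hs _) hα₀ hα₁ hM
    (fun x y => by
      have := hH (t - R ^ 2 / 2, x) (t - R ^ 2 / 2, y)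
      simpa [parDist] using this) hR x x'
  change |heatAverage h (t, x') R - heatAverage h (t, x) R| ≤ _ at h3
  rw [abs_le] at *
  constructor <;> linarith [h1.1, h1.2, h2.1, h2.2, h3.1, h3.2]

/-- The later point is carried back to the time of the earlier one by the heat average with `σ²/2`
equal to the time difference. What remains is a Gaussian average of purely spatial increments over
lengths at most `r + σ|y| ≤ 3r(1 + |y|²)`, which explains the factor 3 and the outer `gaussMoment
d`. -/
lemma abs_sub_le_of_heat_le {h : SpaceTime d → ℝ} (hh : ContDiff ℝ ∞ h)
    (hs : HasCompactSupport h) {α M F : ℝ} (hα₀ : 0 < α) (hα₁ : α < 1) (hM : 0 ≤ M)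
    (hH : IsParHolder α M h) (hF : ∀ z, |heat h z| ≤ F) {R : ℝ} (hR : 0 < R)
    (z w : SpaceTime d) :
    |h z - h w| ≤ 2 * parDist z w ^ 2 * F +
      (2 * R ^ 2 * F + 3 * gaussMoment d * M * R ^ (α - 1) * parDist z w) * gaussMoment d := by
  wlog hzw : w.1 ≤ z.1 generalizing z w
  · rw [abs_sub_comm, parDist_comm]
    exact this w z (not_le.1 hzw).le
  have hF0 : 0 ≤ F := (abs_nonneg _).trans (hF 0)
  have hκ := one_le_gaussMoment (d := d)
  set r := parDist z w
  have hr0 : 0 ≤ r := parDist_nonneg _ _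
  have hδ : z.1 - w.1 ≤ r ^ 2 := (le_abs_self _).trans (abs_fst_sub_le_parDist_sq z w)
  set σ := √(2 * (z.1 - w.1)) with hσ
  have hσ2 : σ ^ 2 = 2 * (z.1 - w.1) := Real.sq_sqrt (by linarith)
  have hσ0 : 0 ≤ σ := Real.sqrt_nonneg _
  have hσr : σ ≤ 2 * r := by nlinarith
  have h1 := abs_sub_heatAverage_le hh hs hF z hσ0
  have e : heatAverage h z σ - h w = ∫ y, (h (w.1, z.2 + σ • y) - h w) * gaussWeight y := by
    have hz : z.1 - σ ^ 2 / 2 = w.1 := by rw [hσ2]; ring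
    obtain ⟨C, hC⟩ := exists_abs_le hh.continuous hs
    have hi : Integrable fun y => h (w.1, z.2 + σ • y) * gaussWeight y := by
      refine integrable_mul_gaussWeight (C := C) (hh.continuous.comp (by fun_prop)) fun y => ?_
      refine (hC _).trans ?_
      nlinarith [mul_nonneg ((abs_nonneg _).trans (hC 0)) (sq_nonneg ‖y‖)]
    simp only [sub_mul]
    rw [integral_sub hi (integrable_gaussWeight.const_mul _), integral_const_mul,
      integral_gaussWeight, mul_one, heatAverage, hz]
  have h2 : |heatAverage h z σ - h w| ≤
      (2 * R ^ 2 * F + 3 * gaussMoment d * M * R ^ (α - 1) * r) * gaussMoment d := by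
    rw [e]
    refine abs_integral_mul_gaussWeight_le fun y => ?_
    have h3 := abs_sub_le_of_heat_le_space hh hs hα₀ hα₁ hM hH hF hR w.1 w.2 (z.2 + σ • y)
    have h4 : ‖z.2 + σ • y - w.2‖ ≤ 3 * r * (1 + ‖y‖ ^ 2) := by
      have : z.2 + σ • y - w.2 = (z.2 - w.2) + σ • y := by abel
      rw [this]
      refine (norm_add_le _ _).trans ?_
      rw [norm_smul, Real.norm_of_nonneg hσ0]
      have h5 : ‖z.2 - w.2‖ ≤ r := norm_snd_sub_le_parDist z w
      have h6 : σ * ‖y‖ ≤ 2 * r * ‖y‖ := by gcongr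
      nlinarith [mul_nonneg hr0 (sq_nonneg (‖y‖ - 1)), mul_nonneg hr0 (sq_nonneg ‖y‖)]
    have hc : 0 ≤ gaussMoment d * M * R ^ (α - 1) := by positivity
    have h7 := mul_le_mul_of_nonneg_left h4 hc
    have h8 : 0 ≤ 2 * R ^ 2 * F * ‖y‖ ^ 2 := by positivity
    calc _ ≤ _ := h3
      _ ≤ 2 * R ^ 2 * F + gaussMoment d * M * R ^ (α - 1) * (3 * r * (1 + ‖y‖ ^ 2)) := by linarith
      _ ≤ _ := by linarith
  have h9 : σ ^ 2 * F ≤ 2 * r ^ 2 * F := by gcongr; linarith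
  rw [abs_le] at *
  constructor <;> linarith [h1.1, h1.2, h2.1, h2.2]

/-! ### Absorption of the Hölder constant -/

/-- A purely qualitative bound: it makes the set of admissible Hölder constants nonempty, without
which absorption would be void. The Lipschitz bound serves up to distance 1, the sup bound beyond.
-/
lemma exists_isParHolder {v : SpaceTime d → ℝ} (hv : ContDiff ℝ ∞ v) (hs : HasCompactSupport v)
    {α : ℝ} (hα₀ : 0 < α) (hα₁ : α < 1) : ∃ M, 0 ≤ M ∧ IsParHolder α M v := by
  obtain ⟨K, hK⟩ := hv.lipschitzWith_of_hasCompactSupport hs (by simp)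
  obtain ⟨B, hB⟩ := exists_abs_le hv.continuous hs
  have hB0 : 0 ≤ B := (abs_nonneg _).trans (hB 0)
  refine ⟨K + 2 * B, by positivity, fun z w => ?_⟩
  have hd := parDist_nonneg z w
  rcases le_total (parDist z w) 1 with h | h
  · have h1 := hK.dist_le_mul z w
    rw [Real.dist_eq, dist_eq_norm, Prod.norm_def] at h1
    have h2 : max ‖(z - w).1‖ ‖(z - w).2‖ ≤ parDist z w := by
      refine max_le ?_ (norm_snd_sub_le_parDist z w)
      refine (abs_fst_sub_le_parDist_sq z w).trans ?_
      nlinarith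
    have h3 : parDist z w ≤ parDist z w ^ α := by
      rcases hd.eq_or_lt with h0 | h0
      · rw [← h0, Real.zero_rpow hα₀.ne']
      · simpa using Real.rpow_le_rpow_of_exponent_ge h0 h hα₁.le
    calc _ ≤ _ := h1
      _ ≤ K * parDist z w ^ α := by gcongr; exact h2.trans h3
      _ ≤ _ := by gcongr; linarith
  · have h1 := Real.one_le_rpow h hα₀.le
    have h2 := abs_sub (v z) (v w)
    have h3 : 2 * B * 1 ≤ 2 * B * parDist z w ^ α := by gcongr
    have h4 : 0 ≤ (K : ℝ) * parDist z w ^ α := by positivity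
    linarith [hB z, hB w]

/-- A Schauder estimate for a smooth function that can be approximated at every scale `T` by
functions with controlled heat operator. -/
lemma exists_isParHolder_of_approx (d : ℕ) {α : ℝ} (hα₀ : 0 < α) (hα₁ : α < 1) :
    ∃ C : ℝ, 0 < C ∧ ∀ (v : SpaceTime d → ℝ) (h : ℝ → SpaceTime d → ℝ) (N : ℝ),
      ContDiff ℝ ∞ v → HasCompactSupport v → (∀ z, 2 < parDist z 0 → v z = 0) → 0 ≤ N →
      (∀ T, 0 < T → T ≤ 1 → ContDiff ℝ ∞ (h T) ∧ HasCompactSupport (h T) ∧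
        (∀ z, |heat (h T) z| ≤ N * T ^ (α - 2)) ∧
        ∀ M, IsParHolder α M v → IsParHolder α M (h T) ∧ ∀ z, |h T z - v z| ≤ M * T ^ α) →
      IsParHolder α (C * N) v := by
  set κ := gaussMoment d with hκ
  have hκ1 : 1 ≤ κ := one_le_gaussMoment
  -- The two errors `|h_T - v| ≤ M(εr)^α` then add up to `M r^α / 4`, and `ε ≤ 1/4` keeps `T = εr ≤
  -- 1` as long as `r ≤ 4`.
  obtain ⟨ε, hε0, hε1, hεα⟩ : ∃ ε : ℝ, 0 < ε ∧ ε ≤ 1 / 4 ∧ ε ^ α = 1 / 8 := by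
    refine ⟨(1 / 8) ^ (1 / α), by positivity, ?_, ?_⟩
    · have : (1 / 8 : ℝ) ^ (1 / α) ≤ (1 / 8) ^ (1 : ℝ) :=
        Real.rpow_le_rpow_of_exponent_ge (by norm_num) (by norm_num)
          (by rw [le_div_iff₀ hα₀]; linarith)
      rw [Real.rpow_one] at this
      linarith
    · rw [← Real.rpow_mul (by norm_num), one_div_mul_cancel hα₀.ne', Real.rpow_one]
  -- With `R = Lr` the term `3κ²M R^(α-1) r` becomes exactly `M r^α / 4`; this is possible because
  -- `α - 1 < 0`.
  obtain ⟨L, hL0, hLα⟩ : ∃ L : ℝ, 0 < L ∧ L ^ (α - 1) = (12 * κ ^ 2)⁻¹ := by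
    refine ⟨(12 * κ ^ 2) ^ (1 / (1 - α)), by positivity, ?_⟩
    have : 1 / (1 - α) * (α - 1) = -1 := by
      have : 1 - α ≠ 0 := by linarith
      field_simp
      ring
    rw [← Real.rpow_mul (by positivity), this, Real.rpow_neg_one]
  -- Collects the two terms containing `F = N(εr)^(α-2)` at `R = Lr`.
  set D := (2 + 2 * L ^ 2 * κ) * ε ^ (α - 2) with hD
  have hD0 : 0 < D := by positivity
  refine ⟨2 * D, by positivity, fun v h N hv hs hsupp hN happ => ?_⟩
  -- one step of the absorption argument
  have step : ∀ M, 0 ≤ M → IsParHolder α M v → IsParHolder α (M / 2 + D * N) v := by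
    intro M hM hH
    have hnear : ∀ z w, parDist z w ≤ 4 → |v z - v w| ≤ (M / 2 + D * N) * parDist z w ^ α := by
      intro z w hzw
      rcases eq_or_ne z w with rfl | hne
      · rw [sub_self, abs_zero]
        exact mul_nonneg (by positivity) (Real.rpow_nonneg (parDist_nonneg _ _) _)
      have hr0 := parDist_pos hne
      set r := parDist z w with hr
      obtain ⟨hT1, hT2, hT3, hT4⟩ := happ (ε * r) (by positivity) (by nlinarith)
      obtain ⟨hT5, hT6⟩ := hT4 M hH
      have key := abs_sub_le_of_heat_le hT1 hT2 hα₀ hα₁ hM hT5 hT3 (R := L * r) (by positivity) z w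
      rw [← hr, ← hκ] at key
      have e1 : (ε * r) ^ α = 1 / 8 * r ^ α := by
        rw [Real.mul_rpow hε0.le hr0.le, hεα]
      have e2 : r ^ 2 * (ε * r) ^ (α - 2) = ε ^ (α - 2) * r ^ α := by
        have : r ^ α = r ^ (α - 2) * r ^ 2 := by
          rw [← Real.rpow_natCast r 2, ← Real.rpow_add hr0]
          norm_num
        rw [Real.mul_rpow hε0.le hr0.le, this]
        ring
      have e3 : (L * r) ^ (α - 1) * r = (12 * κ ^ 2)⁻¹ * r ^ α := by
        have : r ^ α = r ^ (α - 1) * r := by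
          rw [← Real.rpow_add_one hr0.ne']; ring_nf
        rw [Real.mul_rpow hL0.le hr0.le, hLα, this]
        ring
      have e4 : 2 * r ^ 2 * (N * (ε * r) ^ (α - 2)) +
          (2 * (L * r) ^ 2 * (N * (ε * r) ^ (α - 2)) + 3 * κ * M * (L * r) ^ (α - 1) * r) * κ
          = D * N * r ^ α + M / 4 * r ^ α := by
        calc _ = (2 + 2 * L ^ 2 * κ) * N * (r ^ 2 * (ε * r) ^ (α - 2)) +
              3 * κ ^ 2 * M * ((L * r) ^ (α - 1) * r) := by ring
          _ = _ := by rw [e2, e3, hD]; field_simp; ring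
      rw [e4] at key
      have h1 := hT6 z
      have h2 := hT6 w
      rw [e1] at h1 h2
      rw [abs_le] at *
      constructor <;> linarith [h1.1, h1.2, h2.1, h2.2, key.1, key.2]
    -- Beyond distance 4 the zero `w` is traded for a zero at distance exactly 4 from `z`: if `v z ≠
    -- 0` then `|z.1| ≤ 4`, so a time shift by 16 leaves the support.
    have hfar : ∀ z w, 4 < parDist z w → v w = 0 →
        |v z - v w| ≤ (M / 2 + D * N) * parDist z w ^ α := by
      intro z w hzw hw
      by_cases hz : v z = 0
      · rw [hz, hw, sub_self, abs_zero]
        exact mul_nonneg (by positivity) (Real.rpow_nonneg (parDist_nonneg _ _) _)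
      have hz2 : parDist z 0 ≤ 2 := not_lt.1 fun hlt => hz (hsupp z hlt)
      have hd : parDist z (z.1 + 16, z.2) = 4 := by
        have : √(16 : ℝ) = 4 := by
          rw [show (16 : ℝ) = 4 ^ 2 by norm_num]; exact Real.sqrt_sq (by norm_num)
        simp [parDist, this]
      have hz' : v (z.1 + 16, z.2) = 0 := by
        apply hsupp
        by_contra hcon
        have h1 := abs_fst_sub_le_parDist_sq z 0
        have h2 := abs_fst_sub_le_parDist_sq (z.1 + 16, z.2) (0 : SpaceTime d)
        have h3 := parDist_nonneg z 0
        have h4 := parDist_nonneg (z.1 + 16, z.2) (0 : SpaceTime d)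
        rw [abs_le] at h1 h2
        simp only [Prod.fst_zero, sub_zero] at h1 h2
        nlinarith [h1.1, h2.2]
      have := hnear z (z.1 + 16, z.2) hd.le
      rw [hz', hd] at this
      rw [hw]
      refine this.trans ?_
      gcongr
    intro z w
    rcases le_or_gt (parDist z w) 4 with hle | hgt
    · exact hnear z w hle
    · by_cases hw : v w = 0
      · exact hfar z w hgt hw
      · have hz : v z = 0 := by
          by_contra hz
          have hz2 : parDist z 0 ≤ 2 := not_lt.1 fun hlt => hz (hsupp z hlt)
          have hw2 : parDist w 0 ≤ 2 := not_lt.1 fun hlt => hw (hsupp w hlt)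
          have := parDist_triangle z 0 w
          rw [parDist_comm 0 w] at this
          linarith
        rw [abs_sub_comm, parDist_comm]
        exact hfar w z (by rwa [parDist_comm]) hz
  obtain ⟨M₀, hM₀, hH₀⟩ := exists_isParHolder hv hs hα₀ hα₁
  set A : Set ℝ := {M | 0 ≤ M ∧ IsParHolder α M v} with hA
  have hAne : A.Nonempty := ⟨M₀, hM₀, hH₀⟩
  have hAbdd : BddBelow A := ⟨0, fun M hM => hM.1⟩
  -- The set `A` is stable under `M ↦ M/2 + DN`, so its infimum `m` satisfies `m ≤ m/2 + DN`.
  have hinf : sInf A ≤ 2 * D * N := by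
    have : 2 * (sInf A - D * N) ≤ sInf A := by
      refine le_csInf hAne fun M hM => ?_
      have := csInf_le hAbdd (show M / 2 + D * N ∈ A from
        ⟨by have := hM.1; positivity, step M hM.1 hM.2⟩)
      linarith
    linarith
  intro z w
  rcases eq_or_ne z w with rfl | hne
  · rw [sub_self, abs_zero]
    exact mul_nonneg (by positivity) (Real.rpow_nonneg (parDist_nonneg _ _) _)
  have hr0 := Real.rpow_pos_of_pos (parDist_pos hne) α
  rw [← div_le_iff₀ hr0]
  refine le_trans (le_csInf hAne fun M hM => ?_) hinf
  rw [div_le_iff₀ hr0]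
  exact hM.2 z w

/-! ### Convolutions and mollifying kernels -/

instance : (volume : Measure (SpaceTime d)).IsAddHaarMeasure :=
  inferInstanceAs ((volume : Measure ℝ).prod
    (volume : Measure (EuclideanSpace ℝ (Fin d)))).IsAddHaarMeasure

/-- Convolution of real functions on space-time. -/
def conv (f g : SpaceTime d → ℝ) : SpaceTime d → ℝ :=
  f ⋆[ContinuousLinearMap.mul ℝ ℝ, volume] g

lemma conv_apply (f g : SpaceTime d → ℝ) (z : SpaceTime d) :
    conv f g z = ∫ w, f w * g (z - w) := rfl

lemma conv_apply_swap (f g : SpaceTime d → ℝ) (z : SpaceTime d) :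
    conv f g z = ∫ w, f (z - w) * g w := convolution_eq_swap _

lemma conv_comm (f g : SpaceTime d → ℝ) : conv f g = conv g f := by
  ext z
  rw [conv_apply, conv_apply_swap]
  simp only [mul_comm]

lemma _root_.HasCompactSupport.conv {f g : SpaceTime d → ℝ} (hf : HasCompactSupport f)
    (hg : HasCompactSupport g) : HasCompactSupport (conv f g) :=
  HasCompactSupport.convolution _ hf hg

lemma contDiff_conv {f g : SpaceTime d → ℝ} (hf : Continuous f) (hgs : HasCompactSupport g)
    (hg : ContDiff ℝ ∞ g) : ContDiff ℝ ∞ (conv f g) :=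
  hgs.contDiff_convolution_right _ hf.locallyIntegrable hg

lemma integrable_conv {f g : SpaceTime d → ℝ} (hf : Continuous f) (hgs : HasCompactSupport g)
    (hg : Continuous g) (z : SpaceTime d) : Integrable fun w => f w * g (z - w) :=
  hgs.convolutionExists_right (ContinuousLinearMap.mul ℝ ℝ) hf.locallyIntegrable hg z

lemma continuous_conv {f g : SpaceTime d → ℝ} (hf : Continuous f) (hgs : HasCompactSupport g)
    (hg : Continuous g) : Continuous (conv f g) :=
  hgs.continuous_convolution_right _ hf.locallyIntegrable hg

lemma conv_assoc {f g k : SpaceTime d → ℝ} (hf : Continuous f) (hg : Continuous g)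
    (hgs : HasCompactSupport g) (hk : Continuous k) (hks : HasCompactSupport k) :
    conv (conv f g) k = conv f (conv g k) := by
  ext z
  refine convolution_assoc _ _ _ _ (fun x y w => mul_assoc x y w) hf.aestronglyMeasurable
    hg.aestronglyMeasurable hk.aestronglyMeasurable
    (Filter.Eventually.of_forall fun x => integrable_conv hf hgs hg x)
    (Filter.Eventually.of_forall fun x => integrable_conv hg.norm hks.norm hk.norm x) ?_
  exact integrable_conv hf.norm (hgs.norm.conv hks.norm)
    (continuous_conv hg.norm hks.norm hk.norm) z

lemma dirDeriv_conv {f g : SpaceTime d → ℝ} (hf : Continuous f) (hgs : HasCompactSupport g)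
    (hg : ContDiff ℝ ∞ g) (v : SpaceTime d) :
    dirDeriv v (conv f g) = conv f (dirDeriv v g) := by
  ext z
  have h := hgs.hasFDerivAt_convolution_right (ContinuousLinearMap.mul ℝ ℝ)
    (μ := volume) hf.locallyIntegrable (hg.of_le (by simp)) z
  rw [dirDeriv, conv, h.fderiv]
  exact convolution_precompR_apply _ hf.locallyIntegrable (hgs.fderiv ℝ)
    (hg.continuous_fderiv (by simp)) z v

lemma _root_.HasCompactSupport.heat {h : SpaceTime d → ℝ} (hs : HasCompactSupport h) :
    HasCompactSupport (heat h) := by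
  refine HasCompactSupport.intro hs.isCompact fun z hz => ?_
  have h0 : ∀ {k : SpaceTime d → ℝ} (v : SpaceTime d), z ∉ tsupport k →
      z ∉ tsupport (dirDeriv v k) := fun {k} v hk hz' =>
    hk (closure_minimal (fun y hy => support_fderiv_subset ℝ (f := k) (by
      intro h1
      exact hy (by simp [dirDeriv, h1]))) (isClosed_tsupport _) hz')
  rw [ParabolicSchauder.heat, image_eq_zero_of_notMem_tsupport (h0 _ hz)]
  simp only [image_eq_zero_of_notMem_tsupport (h0 _ (h0 _ hz)), Finset.sum_const_zero, sub_zero]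

lemma heat_conv {f g : SpaceTime d → ℝ} (hf : Continuous f) (hgs : HasCompactSupport g)
    (hg : ContDiff ℝ ∞ g) : heat (conv f g) = conv f (heat g) := by
  ext z
  have h1 : ∀ v, Integrable fun w => f w * dirDeriv v g (z - w) := fun v =>
    integrable_conv hf (hgs.dirDeriv v) (hg.dirDeriv v).continuous z
  have h2 : ∀ v, Integrable fun w => f w * dirDeriv v (dirDeriv v g) (z - w) := fun v =>
    integrable_conv hf ((hgs.dirDeriv v).dirDeriv v) ((hg.dirDeriv v).dirDeriv v).continuous z
  rw [heat, conv_apply]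
  simp only [heat, dirDeriv_conv hf hgs hg,
    dirDeriv_conv hf (hgs.dirDeriv _) (hg.dirDeriv _), conv_apply, mul_sub, Finset.mul_sum]
  rw [integral_sub (h1 _) (integrable_finsetSum _ fun i _ => h2 _),
    integral_finsetSum _ fun i _ => h2 _]

namespace MollifierKernel

variable (Ψ : MollifierKernel d) {T : ℝ}

lemma contDiff_scaled_self : ContDiff ℝ ∞ (Ψ.scaled T) := by
  have h : ContDiff ℝ ∞ Ψ.toTest := Ψ.toTest.contDiff
  unfold scaled
  exact contDiff_const.mul (h.comp (by fun_prop))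

lemma hasCompactSupport_scaled_self (hT : 0 < T) : HasCompactSupport (Ψ.scaled T) := by
  have h := (Ψ.hasCompactSupport_scaled hT 0).comp_homeomorph (Homeomorph.neg _)
  simpa [Function.comp_def] using h

lemma scaled_nonneg (hT : 0 < T) (z : SpaceTime d) : 0 ≤ Ψ.scaled T z :=
  mul_nonneg (by positivity) (Ψ.nonneg _)

lemma scaled_eq_zero (hT : 0 < T) {z : SpaceTime d} (hz : T ≤ parDist z 0) : Ψ.scaled T z = 0 := by
  rw [scaled, image_eq_zero_of_notMem_tsupport (f := Ψ.toTest), mul_zero]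
  intro hmem
  have h1 := (Ψ.tsupport_subset hmem).1
  simp only [parDist, Prod.fst_zero, Prod.snd_zero, Prod.fst_neg, Prod.snd_neg, zero_sub, neg_neg,
    max_lt_iff, norm_smul, abs_mul, sub_zero] at h1 hz
  obtain ⟨h1, h2⟩ := h1
  rw [norm_inv, Real.norm_of_nonneg hT.le, inv_mul_lt_iff₀ hT, mul_one] at h1
  rw [Real.sqrt_mul (abs_nonneg _), abs_of_nonneg (by positivity), Real.sqrt_inv,
    Real.sqrt_sq hT.le, inv_mul_lt_iff₀ hT, mul_one] at h2
  exact absurd hz (not_le.2 (max_lt h1 h2))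

lemma integral_scaled (hT : 0 < T) : ∫ z, Ψ.scaled T z = 1 := by
  have hc : Continuous Ψ.toTest := Ψ.toTest.contDiff.continuous
  have hi : Integrable (Ψ.toTest : SpaceTime d → ℝ) :=
    hc.integrable_of_hasCompactSupport Ψ.toTest.hasCompactSupport
  have hi' : Integrable (Ψ.scaled T) :=
    Ψ.contDiff_scaled_self.continuous.integrable_of_hasCompactSupport
      (Ψ.hasCompactSupport_scaled_self hT)
  rw [Measure.volume_eq_prod, integral_prod _ hi']
  have h1 : ∀ t : ℝ, ∫ x, Ψ.scaled T (t, x)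
      = (T ^ 2)⁻¹ * ∫ x, Ψ.toTest ((T ^ 2)⁻¹ * t, x) := by
    intro t
    simp only [scaled]
    rw [integral_const_mul, Measure.integral_comp_inv_smul_of_nonneg volume
      (fun x => Ψ.toTest ((T ^ 2)⁻¹ * t, x)) hT.le]
    simp only [finrank_euclideanSpace, Fintype.card_fin, smul_eq_mul]
    field_simp
    ring
  simp only [h1]
  rw [integral_const_mul]
  have h2 := Measure.integral_comp_inv_smul_of_nonneg (volume : Measure ℝ)
    (fun t => ∫ x, Ψ.toTest (t, x)) (sq_nonneg T)
  simp only [smul_eq_mul, Module.finrank_self, pow_one] at h2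
  rw [h2, ← integral_prod _ hi, ← Measure.volume_eq_prod, Ψ.integral_eq_one]
  field_simp

lemma integrable_mul_scaled (hT : 0 < T) {φ : SpaceTime d → ℝ} (hφ : Continuous φ) :
    Integrable fun w => φ w * Ψ.scaled T w :=
  (hφ.mul Ψ.contDiff_scaled_self.continuous).integrable_of_hasCompactSupport
    (Ψ.hasCompactSupport_scaled_self hT).mul_left

lemma abs_integral_mul_scaled_le (hT : 0 < T) {φ : SpaceTime d → ℝ} {B : ℝ}
    (hB : ∀ w, parDist w 0 < T → |φ w| ≤ B) : |∫ w, φ w * Ψ.scaled T w| ≤ B := by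
  have h1 : ∫ w, B * Ψ.scaled T w = B := by
    rw [integral_const_mul, Ψ.integral_scaled hT, mul_one]
  rw [← h1, ← Real.norm_eq_abs]
  refine norm_integral_le_of_norm_le
    (Ψ.integrable_mul_scaled hT continuous_const) (Filter.Eventually.of_forall fun w => ?_)
  rw [norm_mul, Real.norm_of_nonneg (Ψ.scaled_nonneg hT w)]
  rcases lt_or_ge (parDist w 0) T with h | h
  · exact mul_le_mul_of_nonneg_right (hB w h) (Ψ.scaled_nonneg hT w)
  · rw [Ψ.scaled_eq_zero hT h, mul_zero, mul_zero]

lemma abs_conv_scaled_le (hT : 0 < T) {f : SpaceTime d → ℝ} {B : ℝ} (hB : ∀ z, |f z| ≤ B)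
    (z : SpaceTime d) : |conv f (Ψ.scaled T) z| ≤ B := by
  rw [conv_apply_swap]
  exact Ψ.abs_integral_mul_scaled_le hT fun w _ => hB _

lemma abs_conv_scaled_sub_le (hT : 0 < T) {f : SpaceTime d → ℝ} (hf : Continuous f) {B : ℝ}
    {z : SpaceTime d} (hB : ∀ w, parDist w 0 < T → |f (z - w) - f z| ≤ B) :
    |conv f (Ψ.scaled T) z - f z| ≤ B := by
  have : conv f (Ψ.scaled T) z - f z = ∫ w, (f (z - w) - f z) * Ψ.scaled T w := by
    simp only [sub_mul]
    rw [integral_sub (Ψ.integrable_mul_scaled hT (φ := fun w => f (z - w)) (hf.comp (by fun_prop)))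
      (Ψ.integrable_mul_scaled hT continuous_const), integral_const_mul, Ψ.integral_scaled hT,
      mul_one, conv_apply_swap]
  rw [this]
  exact Ψ.abs_integral_mul_scaled_le hT hB

lemma abs_conv_scaled_sub_le_of_isParHolder (hT : 0 < T) {f : SpaceTime d → ℝ}
    (hf : Continuous f) {α M : ℝ} (hα : 0 ≤ α) (hM : 0 ≤ M) (hH : IsParHolder α M f)
    (z : SpaceTime d) : |conv f (Ψ.scaled T) z - f z| ≤ M * T ^ α := by
  refine Ψ.abs_conv_scaled_sub_le hT hf fun w hw => (hH _ _).trans ?_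
  have h : parDist (z - w) z = parDist w 0 := by simp [parDist]
  rw [h]
  have := parDist_nonneg w 0
  gcongr

lemma isParHolder_conv_scaled (hT : 0 < T) {f : SpaceTime d → ℝ} (hf : Continuous f) {α M : ℝ}
    (hH : IsParHolder α M f) : IsParHolder α M (conv f (Ψ.scaled T)) := by
  intro z z'
  have : conv f (Ψ.scaled T) z - conv f (Ψ.scaled T) z'
      = ∫ w, (f (z - w) - f (z' - w)) * Ψ.scaled T w := by
    simp only [sub_mul]
    rw [integral_sub (Ψ.integrable_mul_scaled hT (φ := fun w => f (z - w)) (hf.comp (by fun_prop)))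
      (Ψ.integrable_mul_scaled hT (φ := fun w => f (z' - w)) (hf.comp (by fun_prop))), conv_apply_swap, conv_apply_swap]
  rw [this]
  refine Ψ.abs_integral_mul_scaled_le hT fun w _ => (hH _ _).trans_eq ?_
  rw [parDist_sub_right]

end MollifierKernel

/-! ### The mollified distribution as a classical convolution -/

lemma heatOp_toDistribution_apply {u : SpaceTime d → ℝ} (hu : Continuous u)
    (η : 𝓓((⊤ : Opens (SpaceTime d)), ℝ)) :
    heatOp (toDistribution u) η = -(∫ w, dirDeriv timeDir η w * u w) -
      ∑ i, ∫ w, dirDeriv (spaceDir i) (dirDeriv (spaceDir i) η) w * u w := by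
  have hloc : LocallyIntegrableOn u ((⊤ : Opens (SpaceTime d)) : Set (SpaceTime d)) volume :=
    hu.locallyIntegrable.locallyIntegrableOn _
  have hD : ∀ φ, toDistribution u φ = ∫ w, φ w * u w := fun φ =>
    TestFunction.integralAgainstBilinCLM_eq_integral hloc
  have hder : ∀ (v : SpaceTime d) (φ : 𝓓((⊤ : Opens (SpaceTime d)), ℝ)),
      (LineDeriv.lineDerivOp v φ : SpaceTime d → ℝ) = dirDeriv v φ := by
    intro v φ
    ext w
    rw [TestFunction.lineDerivOp_eq_lineDerivCLM ℝ,
      TestFunction.lineDerivCLM_apply_of_le (by simp),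
      (φ.contDiff.differentiable (by simp)).differentiableAt.lineDeriv_eq_fderiv]
    rfl
  have happ : ∀ (f g : 𝓓'((⊤ : Opens (SpaceTime d)), ℝ)) , (f - g) η = f η - g η := fun _ _ => rfl
  have hsum : ∀ f : Fin d → 𝓓'((⊤ : Opens (SpaceTime d)), ℝ), (∑ i, f i) η = ∑ i, f i η := by
    intro f
    exact map_sum
      (⟨⟨fun g => g η, rfl⟩, fun _ _ => rfl⟩ : 𝓓'((⊤ : Opens (SpaceTime d)), ℝ) →+ ℝ) f _
  rw [heatOp, happ, hsum]
  simp only [Distribution.lineDerivOp_apply_apply, map_neg, neg_neg, sub_eq_add_neg]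
  simp only [hD, hder]
  rfl

/-- The reflection `w ↦ z - w` flips the sign of each derivative: for `∂ₜ` this cancels the sign
from duality, and for the second derivatives the signs cancel in pairs. -/
lemma mollify_heatOp_toDistribution (Ψ : MollifierKernel d) (T : Set.Ioc (0 : ℝ) 1)
    {u : SpaceTime d → ℝ} (hu : Continuous u) (z : SpaceTime d) :
    mollify Ψ T (heatOp (toDistribution u)) z = conv u (heat (Ψ.scaled T)) z := by
  have hs := Ψ.hasCompactSupport_scaled_self T.2.1
  have hc : ContDiff ℝ ∞ (Ψ.scaled T) := Ψ.contDiff_scaled_self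
  have hrefl : ∀ {k : SpaceTime d → ℝ} (v : SpaceTime d),
      dirDeriv v (fun w => k (z - w)) = fun w => -dirDeriv v k (z - w) := by
    intro k v
    ext w
    have h1 : (fun w => k (z - w))
        = (fun y => k (z + y)) ∘ (ContinuousLinearEquiv.neg ℝ : SpaceTime d ≃L[ℝ] SpaceTime d) := by
      ext w
      simp [sub_eq_add_neg]
    rw [dirDeriv, h1, ContinuousLinearEquiv.comp_right_fderiv, fderiv_comp_add_left]
    simp [dirDeriv, sub_eq_add_neg]
  have hneg : ∀ {k : SpaceTime d → ℝ} (v : SpaceTime d),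
      dirDeriv v (fun w => -k w) = fun w => -dirDeriv v k w := by
    intro k v
    ext w
    rw [dirDeriv, fderiv_fun_neg]
    rfl
  have htest : (Ψ.testAt T z : SpaceTime d → ℝ) = fun w => Ψ.scaled T (z - w) := rfl
  rw [mollify, heatOp_toDistribution_apply hu, htest, conv_apply]
  have h1 : Integrable fun w => u w * dirDeriv timeDir (Ψ.scaled T) (z - w) :=
    integrable_conv hu (hs.dirDeriv _) (hc.dirDeriv _).continuous z
  have h2 : ∀ i, Integrable fun w =>
      u w * dirDeriv (spaceDir i) (dirDeriv (spaceDir i) (Ψ.scaled T)) (z - w) := fun i =>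
    integrable_conv hu ((hs.dirDeriv _).dirDeriv _) ((hc.dirDeriv _).dirDeriv _).continuous z
  simp only [heat, hrefl, hneg, neg_neg, mul_sub, Finset.mul_sum]
  rw [integral_sub h1 (integrable_finsetSum _ fun i _ => h2 i), integral_finsetSum _ fun i _ => h2 i]
  simp only [neg_mul, integral_neg, neg_neg, mul_comm (u _)]

/-! ### From smooth to continuous functions -/

lemma exists_pos_abs_conv_scaled_sub_le (Ψ : MollifierKernel d) {u : SpaceTime d → ℝ}
    (hu : Continuous u) (z : SpaceTime d) {η : ℝ} (hη : 0 < η) :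
    ∃ δ > 0, ∀ s, 0 < s → s ≤ δ → |conv u (Ψ.scaled s) z - u z| ≤ η := by
  obtain ⟨δ, hδ, hball⟩ := Metric.continuousAt_iff.1 hu.continuousAt η hη
  refine ⟨min δ 1, lt_min hδ one_pos, fun s hs hsδ => ?_⟩
  refine Ψ.abs_conv_scaled_sub_le hs hu fun w hw => ?_
  have h1 : parDist w 0 < min δ 1 := hw.trans_le hsδ
  have h2 := norm_snd_sub_le_parDist w 0
  have h3 := abs_fst_sub_le_parDist_sq w 0
  have h4 := parDist_nonneg w 0
  have h5 : ‖w‖ ≤ parDist w 0 := by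
    rw [Prod.norm_def]
    refine max_le ?_ (by simpa using h2)
    have : ‖w.1‖ ≤ parDist w 0 ^ 2 := by simpa using h3
    nlinarith [h1.trans_le (min_le_right δ 1)]
  have hdist : dist (z - w) z < δ := by
    rw [dist_eq_norm]
    simpa using h5.trans_lt (h1.trans_le (min_le_left δ 1))
  have := hball hdist
  rw [Real.dist_eq] at this
  exact this.le

/-- Since convolutions commute, a sup bound on `conv u (heat (Ψ.scaled T))` passes to the
mollification of `u` at any scale `s` with no loss. -/
lemma heat_conv_conv_scaled (Ψ : MollifierKernel d) {u : SpaceTime d → ℝ} (hu : Continuous u)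
    {s T : ℝ} (hs : 0 < s) (hT : 0 < T) :
    heat (conv (conv u (Ψ.scaled s)) (Ψ.scaled T))
      = conv (conv u (heat (Ψ.scaled T))) (Ψ.scaled s) := by
  have hs1 := Ψ.hasCompactSupport_scaled_self hs
  have hs2 : ContDiff ℝ ∞ (Ψ.scaled s) := Ψ.contDiff_scaled_self
  have hT1 := Ψ.hasCompactSupport_scaled_self hT
  have hT2 : ContDiff ℝ ∞ (Ψ.scaled T) := Ψ.contDiff_scaled_self
  rw [heat_conv (continuous_conv hu hs1 hs2.continuous) hT1 hT2,
    conv_assoc hu hs2.continuous hs1 hT2.heat.continuous hT1.heat,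
    conv_comm (Ψ.scaled s), ← conv_assoc hu hT2.heat.continuous hT1.heat hs2.continuous hs1]

lemma exists_isParHolder_of_mollify_le (d : ℕ) {α : ℝ} (hα₀ : 0 < α) (hα₁ : α < 1) :
    ∃ C : ℝ, 0 < C ∧ ∀ (Ψ : MollifierKernel d) (u : SpaceTime d → ℝ) (N : ℝ),
      Continuous u → HasCompactSupport u → (∀ z, 1 < parDist z 0 → u z = 0) → 0 ≤ N →
      (∀ T, 0 < T → T ≤ 1 → ∀ z, |conv u (heat (Ψ.scaled T)) z| ≤ N * T ^ (α - 2)) →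
      IsParHolder α (C * N) u := by
  obtain ⟨C, hC, hmain⟩ := exists_isParHolder_of_approx d hα₀ hα₁
  refine ⟨C, hC, fun Ψ u N hu hus hsupp hN hbound => ?_⟩
  have hsmooth : ∀ s, 0 < s → s ≤ 1 → IsParHolder α (C * N) (conv u (Ψ.scaled s)) := by
    intro s hs hs1
    have hv : ContDiff ℝ ∞ (conv u (Ψ.scaled s)) :=
      contDiff_conv hu (Ψ.hasCompactSupport_scaled_self hs) Ψ.contDiff_scaled_self
    have hvs := hus.conv (Ψ.hasCompactSupport_scaled_self hs)
    refine hmain _ (fun T => conv (conv u (Ψ.scaled s)) (Ψ.scaled T)) N hv hvs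
      (fun z hz => ?_) hN fun T hT hT1 => ⟨contDiff_conv hv.continuous
        (Ψ.hasCompactSupport_scaled_self hT) Ψ.contDiff_scaled_self,
        hvs.conv (Ψ.hasCompactSupport_scaled_self hT), fun z => ?_, fun M hM => ⟨?_, fun z => ?_⟩⟩
    -- The support grows from radius 1 to at most `1 + s ≤ 2`, whence the radius 2 in the absorption
    -- lemma.
    · rw [← abs_nonpos_iff, conv_apply_swap]
      refine Ψ.abs_integral_mul_scaled_le hs fun w hw => ?_
      rw [hsupp (z - w), abs_zero]
      have h1 := parDist_triangle z (z - w) 0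
      have h2 : parDist z (z - w) = parDist w 0 := by simp [parDist]
      linarith
    · rw [heat_conv_conv_scaled Ψ hu hs hT]
      exact Ψ.abs_conv_scaled_le hs (hbound T hT hT1) z
    · exact Ψ.isParHolder_conv_scaled hT hv.continuous hM
    -- The points `(1, 0)` and `0` are at parabolic distance 1, so the Hölder bound there reads `0 ≤
    -- M`.
    · have hM0 : 0 ≤ M := by
        have := (abs_nonneg _).trans (hM (1, 0) 0)
        simpa [parDist] using this
      exact Ψ.abs_conv_scaled_sub_le_of_isParHolder hT hv.continuous hα₀.le hM0 hM z
  intro z w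
  -- The Hölder constant is uniform in `s`, so pointwise convergence at the two points as `s → 0`
  -- suffices.
  refine le_of_forall_pos_le_add fun η hη => ?_
  obtain ⟨δ₁, hδ₁, h₁⟩ := exists_pos_abs_conv_scaled_sub_le Ψ hu z (half_pos hη)
  obtain ⟨δ₂, hδ₂, h₂⟩ := exists_pos_abs_conv_scaled_sub_le Ψ hu w (half_pos hη)
  set s := min (min δ₁ δ₂) 1 with hs
  have hs0 : 0 < s := lt_min (lt_min hδ₁ hδ₂) one_pos
  have a := h₁ s hs0 ((min_le_left _ _).trans (min_le_left _ _))
  have b := h₂ s hs0 ((min_le_left _ _).trans (min_le_right _ _))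
  have c := hsmooth s hs0 (min_le_right _ _) z w
  rw [abs_le] at *
  constructor <;> linarith [a.1, a.2, b.1, b.2, c.1, c.2]

end

end ParabolicSchauder

/-! ### The estimate in extended reals -/

open ParabolicSchauder in
theorem lemma5p1 (d : ℕ) (α : ℝ) (hα₀ : 0 < α) (hα₁ : α < 1) :
    ∃ C : ℝ≥0, ∀ (Ψ : ParabolicSchauder.MollifierKernel d)
      (u : ParabolicSchauder.SpaceTime d → ℝ),
      Continuous u → HasCompactSupport u → tsupport u ⊆ ParabolicSchauder.parBall 0 1 →
      ParabolicSchauder.holderSeminorm α u ≤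
        C * ParabolicSchauder.negHolderSeminorm Ψ α
          (ParabolicSchauder.heatOp (ParabolicSchauder.toDistribution u)) := by
  obtain ⟨C, hC, hmain⟩ := exists_isParHolder_of_mollify_le d hα₀ hα₁
  refine ⟨C.toNNReal, fun Ψ u hu hus hsupp => ?_⟩
  set K := negHolderSeminorm Ψ α (heatOp (toDistribution u)) with hK
  change _ ≤ ENNReal.ofReal C * K
  -- When the right-hand seminorm is infinite, `C > 0` is what rules out the convention `0 * ⊤ = 0`.
  rcases eq_or_ne K ⊤ with htop | hfin
  · rw [htop, ENNReal.mul_top (by simpa using hC)]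
    exact le_top
  have hH : IsParHolder α (C * K.toReal) u := by
    refine hmain Ψ u K.toReal hu hus (fun z hz => ?_) ENNReal.toReal_nonneg fun T hT hT1 z => ?_
    · by_contra hne
      have h1 : parDist 0 z < 1 := (hsupp (subset_tsupport u hne)).1
      rw [parDist_comm] at h1
      linarith
    · rw [← mollify_heatOp_toDistribution Ψ ⟨T, hT, hT1⟩ hu z]
      set m := mollify Ψ ⟨T, hT, hT1⟩ (heatOp (toDistribution u)) z with hm
      have h1 : ENNReal.ofReal (T ^ (2 - α)) * ENNReal.ofReal |m| ≤ K :=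
        (mul_le_mul_right (le_iSup
          (fun z => ENNReal.ofReal |mollify Ψ ⟨T, hT, hT1⟩ (heatOp (toDistribution u)) z|) z) _).trans
          (le_iSup (fun T : Set.Ioc (0 : ℝ) 1 => ENNReal.ofReal ((T : ℝ) ^ (2 - α)) *
            supNorm (mollify Ψ T (heatOp (toDistribution u)))) ⟨T, hT, hT1⟩)
      rw [← ENNReal.ofReal_mul (by positivity), ENNReal.ofReal_le_iff_le_toReal hfin] at h1
      have h2 : T ^ (α - 2) = (T ^ (2 - α))⁻¹ := by
        rw [← Real.rpow_neg hT.le, neg_sub]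
      rw [h2, ← div_eq_mul_inv, le_div_iff₀ (by positivity), mul_comm]
      exact h1
  rw [holderSeminorm]
  refine iSup_le fun z => iSup_le fun w => iSup_le fun hzw => ?_
  rw [← ENNReal.ofReal_toReal hfin, ← ENNReal.ofReal_mul hC.le]
  refine ENNReal.ofReal_le_ofReal ?_
  rw [div_le_iff₀ (Real.rpow_pos_of_pos (parDist_pos hzw) α)]
  exact hH z w
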